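/- **Theorem 2.1 (Fundamental Theorem of Commutator Theory in Loops).** *Definitions.* A loop is an algebra $(Q,1,\cdot,\backslash,/)$ satisfying the identities $x\cdot 1=x=1\cdot x$, $x\backslash(x\cdot y)=y=x\cdot(x\backslash y)$ and $(y\cdot x)/x=y=(y/x)\cdot x$. A variety of loops is the class of all loops that satisfy some given set of identities between loop terms. A congruence of $Q$ is an equivalence relation compatible with all the loop operations. For $x\in Q$ let $L_x(y)=xy$, $R_x(y)=yx$, $M_x(y)=y\backslash x$; these are permutations of $Q$. The total multiplication group of $Q$ is the permutation group generated by all $L_x,R_x,M_x$ with $x\in Q$, and the total inner mapping group $\mathrm{TotInn}(Q)$ is the stabilizer of $1$ in it. A word $W=W_{\bar x}$ in parameters $\bar x=x_1,\dots,x_n$ ($n\ge 0$ may depend on $W$) is an element of the free group on the letters $K_t$, where $K\in\{L,R,M\}$ and $t$ is a loop term over $x_1,\dots,x_n$. For $\bar a\in Q^n$, $W_{\bar a}$ denotes the permutation of $Q$ obtained by replacing every letter $K_{t}$ by the mapping $K_{t(\bar a)}$ and composing. A set $\mathcal W$ of words generates total inner mapping groups in a variety $\mathcal V$ if every $W\in\mathcal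 W$ is inner for $\mathcal V$ (that is, $W_{\bar a}\in \mathrm{TotInn}(Q)$ for all $Q\in\mathcal V$ and all tuples $\bar a$ over $Q$) and, for every $Q\in\mathcal V$, $$\mathrm{TotInn}(Q)=\langle W_{\bar a}\;;\;W\in\mathcal W,\ \bar a \text{ a tuple over } Q\rangle .$$ For congruences $\alpha,\beta,\delta$ of $Q$ write $C(\alpha,\beta;\delta)$ if for every $n\geq 0$, every $(n+1)$-ary loop term $t$, all $a\,\alpha\,b$ and all $u_1\,\beta\,v_1,\dots,u_n\,\beta\,v_n$, $$t(a,u_1,\dots,u_n)\;\delta\;t(a,v_1,\dots,v_n)\quad\text{implies}\quad t(b,u_1,\dots,u_n)\;\delta\;t(b,v_1,\dots,v_n).$$ The (Freese–McKenzie) commutator $[\alpha,\beta]$ is the smallest congruence $\delta$ of $Q$ with $C(\alpha,\beta;\delta)$. *Theorem.* Let $\mathcal V$ be a variety of loops and let $\mathcal W$ be a set of words that generates total inner mapping groups in $\mathcal V$. Then for every $Q\in\mathcal V$ and all congruences $\alpha,\beta$ of $Q$, the commutator $[\alpha,\beta]$ is the congruence of $Q$ generated by all pairs $$(W_{\bar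 u}(a),\,W_{\bar v}(a)),$$ where $W\in\mathcal W$, $a\in Q$ with $1\,\alpha\,a$, and $\bar u,\bar v$ are tuples over $Q$ (of length the number of parameters of $W$) with $u_i\,\beta\,v_i$ for all $i$. -/

import Mathlib

universe u

namespace LoopTheory

/-- A loop, as a universal algebra `(Q, 1, ·, \, /)`; `ldiv x y` is `x \ y`. -/
class Loop (Q : Type u) extends MulOneClass Q, Div Q where
  ldiv : Q → Q → Q
  ldiv_mul_cancel_left : ∀ x y : Q, ldiv x (x * y) = y
  mul_ldiv_cancel_left : ∀ x y : Q, x * ldiv x y = y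
  mul_div_cancel_right : ∀ x y : Q, (y * x) / x = y
  div_mul_cancel_right : ∀ x y : Q, (y / x) * x = y

/-- Loop terms over a set `X` of variables. -/
inductive LoopTerm (X : Type) : Type
  | var (x : X) : LoopTerm X
  | one : LoopTerm X
  | mul (s t : LoopTerm X) : LoopTerm X
  | ldiv (s t : LoopTerm X) : LoopTerm X
  | rdiv (s t : LoopTerm X) : LoopTerm X

/-- The value of a term in the loop `Q` under an assignment of the variables. -/
def LoopTerm.eval {Q : Type u} [Loop Q] {X : Type} (ρ : X → Q) : LoopTerm X → Q
  | .var x => ρ x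
  | .one => 1
  | .mul s t => s.eval ρ * t.eval ρ
  | .ldiv s t => Loop.ldiv (s.eval ρ) (t.eval ρ)
  | .rdiv s t => s.eval ρ / t.eval ρ

/-! ### Varieties -/

/-- A class of loops (in a fixed universe). -/
abbrev LoopClass : Type (u + 1) := ∀ (Q : Type u) [Loop Q], Prop

/-- A variety of loops: the class of all loops that satisfy some given set of identities. -/
def IsVariety (V : LoopClass.{u}) : Prop :=
  ∃ E : Set (LoopTerm ℕ × LoopTerm ℕ), ∀ (Q : Type u) [Loop Q],
    V Q ↔ ∀ e ∈ E, ∀ ρ : ℕ → Q, e.1.eval ρ = e.2.eval ρ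

/-! ### Translations and (total) inner mappings -/

/-- The left translation `L_x : y ↦ x y`. -/
def leftTrans {Q : Type u} [Loop Q] (x : Q) : Equiv.Perm Q where
  toFun y := x * y
  invFun y := Loop.ldiv x y
  left_inv y := Loop.ldiv_mul_cancel_left x y
  right_inv y := Loop.mul_ldiv_cancel_left x y

/-- The right translation `R_x : y ↦ y x`. -/
def rightTrans {Q : Type u} [Loop Q] (x : Q) : Equiv.Perm Q where
  toFun y := y * x
  invFun y := y / x
  left_inv y := Loop.mul_div_cancel_right x y
  right_inv y := Loop.div_mul_cancel_right x y

/-- The mapping `M_x : y ↦ y \ x`, with inverse `y ↦ x / y`. -/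
def midTrans {Q : Type u} [Loop Q] (x : Q) : Equiv.Perm Q where
  toFun y := Loop.ldiv y x
  invFun y := x / y
  left_inv y := by
    have h := Loop.mul_div_cancel_right (Loop.ldiv y x) y
    rwa [Loop.mul_ldiv_cancel_left] at h
  right_inv y := by
    have h := Loop.ldiv_mul_cancel_left (x / y) y
    rwa [Loop.div_mul_cancel_right] at h

/-- The total multiplication group, generated by all `L_x`, `R_x`, `M_x`. -/
def totMlt (Q : Type u) [Loop Q] : Subgroup (Equiv.Perm Q) :=
  Subgroup.closure (Set.range leftTrans ∪ Set.range rightTrans ∪ Set.range midTrans)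

/-- The total inner mapping group: the stabilizer of `1` in the total multiplication group. -/
def totInn (Q : Type u) [Loop Q] : Subgroup (Equiv.Perm Q) :=
  totMlt Q ⊓ MulAction.stabilizer (Equiv.Perm Q) (1 : Q)

/-! ### Words -/

/-- The three kinds of letters. -/
inductive TransKind : Type
  | L
  | R
  | M

/-- The translation of `Q` of the given kind by the given element. -/
def TransKind.toPerm {Q : Type u} [Loop Q] : TransKind → Q → Equiv.Perm Q
  | .L => leftTrans
  | .R => rightTrans
  | .M => midTrans

/-- A word in the parameters `x_1, …, x_n`: an element of the free group on the letters `K_t`,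
with `K ∈ {L, R, M}` and `t` a loop term over `x_1, …, x_n`. -/
abbrev Word (n : ℕ) : Type := FreeGroup (TransKind × LoopTerm (Fin n))

/-- The permutation `W_ā` of `Q` induced by a word `W` and a tuple `ā` over `Q`. -/
def Word.eval {Q : Type u} [Loop Q] {n : ℕ} (w : Word n) (a : Fin n → Q) : Equiv.Perm Q :=
  FreeGroup.lift (fun k : TransKind × LoopTerm (Fin n) => k.1.toPerm (k.2.eval a)) w

/-- The word `w` is inner for `V`: it induces total inner mappings only, in all loops of `V`. -/
def Word.IsInner (V : LoopClass.{u}) {n : ℕ} (w : Word n) : Prop :=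
  ∀ (Q : Type u) [Loop Q], V Q → ∀ a : Fin n → Q, w.eval a ∈ totInn Q

/-- A set of words, with any numbers of parameters, generates total inner mapping groups in `V`. -/
def GeneratesTotInn (V : LoopClass.{u}) (𝒲 : Set (Σ n : ℕ, Word n)) : Prop :=
  (∀ w ∈ 𝒲, w.2.IsInner V) ∧
    ∀ (Q : Type u) [Loop Q], V Q →
      totInn Q = Subgroup.closure {f | ∃ w ∈ 𝒲, ∃ a : Fin w.1 → Q, f = w.2.eval a}

/-! ### Congruences and the commutator -/

/-- A congruence of a loop: an equivalence relation compatible with all loop operations. -/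
structure LoopCon (Q : Type u) [Loop Q] extends Con Q where
  ldiv' : ∀ {w x y z : Q}, toSetoid w x → toSetoid y z → toSetoid (Loop.ldiv w y) (Loop.ldiv x z)
  rdiv' : ∀ {w x y z : Q}, toSetoid w x → toSetoid y z → toSetoid (w / y) (x / z)

namespace LoopCon

variable {Q : Type u} [Loop Q]

/-- The relation underlying a congruence: `α.Rel a b` is `a α b`. -/
def Rel (α : LoopCon Q) (a b : Q) : Prop := α.toSetoid a b

theorem ext_rel {α β : LoopCon Q} (h : ∀ a b, α.Rel a b ↔ β.Rel a b) : α = β := by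
  obtain ⟨α, _, _⟩ := α
  obtain ⟨β, _, _⟩ := β
  have : α = β := Con.ext h
  subst this
  rfl

instance : PartialOrder (LoopCon Q) where
  le α β := ∀ a b, α.Rel a b → β.Rel a b
  le_refl _ _ _ h := h
  le_trans _ _ _ h₁ h₂ a b h := h₂ a b (h₁ a b h)
  le_antisymm _ _ h₁ h₂ := ext_rel fun a b => ⟨h₁ a b, h₂ a b⟩

/-- Intersections of congruences. -/
instance : InfSet (LoopCon Q) where
  sInf S :=
    { r := fun a b => ∀ α ∈ S, α.Rel a b
      iseqv :=
        ⟨fun a α _ => α.iseqv.refl a, fun h α hα => α.iseqv.symm (h α hα),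
          fun h₁ h₂ α hα => α.iseqv.trans (h₁ α hα) (h₂ α hα)⟩
      mul' := fun h₁ h₂ α hα => α.mul' (h₁ α hα) (h₂ α hα)
      ldiv' := fun h₁ h₂ α hα => α.ldiv' (h₁ α hα) (h₂ α hα)
      rdiv' := fun h₁ h₂ α hα => α.rdiv' (h₁ α hα) (h₂ α hα) }

theorem sInf_rel {S : Set (LoopCon Q)} {a b : Q} :
    (sInf S).Rel a b ↔ ∀ α ∈ S, α.Rel a b := Iff.rfl

/-- `Cg(X)`: the congruence generated by a set of pairs. -/
def gen (X : Set (Q × Q)) : LoopCon Q :=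
  sInf {δ | ∀ p ∈ X, δ.Rel p.1 p.2}

/-- `Cg(X)` is the least congruence containing `X`. -/
theorem isLeast_gen (X : Set (Q × Q)) :
    IsLeast {δ : LoopCon Q | ∀ p ∈ X, δ.Rel p.1 p.2} (gen X) :=
  ⟨fun p hp _ hδ => hδ p hp, fun _ hδ _ _ h => h _ hδ⟩

/-- `C(α, β; δ)`: the term condition holds for all `(n + 1)`-ary terms `t`. -/
def Centralizes (α β δ : LoopCon Q) : Prop :=
  ∀ (n : ℕ) (t : LoopTerm (Fin (n + 1))) (a b : Q) (u v : Fin n → Q),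
    α.Rel a b → (∀ i, β.Rel (u i) (v i)) →
    δ.Rel (t.eval (Fin.cons a u : Fin (n + 1) → Q)) (t.eval (Fin.cons a v : Fin (n + 1) → Q)) →
    δ.Rel (t.eval (Fin.cons b u : Fin (n + 1) → Q)) (t.eval (Fin.cons b v : Fin (n + 1) → Q))

/-- The Freese–McKenzie commutator `[α, β]`: the least `δ` with `C(α, β; δ)`. -/
def commutator (α β : LoopCon Q) : LoopCon Q :=
  sInf {δ | Centralizes α β δ}

/-- The least `δ` with `C(α, β; δ)` exists, and `commutator α β` is it. -/
theorem isLeast_commutator (α β : LoopCon Q) :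
    IsLeast {δ : LoopCon Q | Centralizes α β δ} (commutator α β) :=
  ⟨fun n t a b u v hab huv h δ hδ => hδ n t a b u v hab huv (h δ hδ),
    fun _ hδ _ _ h => h _ hδ⟩

end LoopCon

end LoopTheory

namespace LoopTheory

/-! Let `δ` be the congruence generated by the pairs. It lies below `[α, β]` because `W_ū(a)` is a
term in `a, ū` with value `1` at `a = 1` (`W` is inner), so the term condition moves `1` to `a`.
Conversely, `δ` must satisfy the term condition. View `β` as a subloop of `Q × Q`; it lies in the
variety, so `𝒲` generates its total inner mappings too, and these act coordinatewise as `(W_ū,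
W_v̄)` with `ū β v̄`. Hence `N = {(x, y) ∈ β : 1 α x, x δ y}` is a normal subloop of `β`
(`isNormalSubloop_nearDiagonal`). Modulo `N`, `(a, a)` and `(b, b)` agree whenever `a α b`, and
comparing the values of a term at these two pairs gives the term condition
(`centralizes_of_isNormalSubloop`). -/

theorem perm_apply_inv_self {X : Type*} (f : Equiv.Perm X) (x : X) : f (f⁻¹ x) = x :=
  f.apply_symm_apply x

theorem perm_inv_apply_self {X : Type*} (f : Equiv.Perm X) (x : X) : f⁻¹ (f x) = x :=
  f.symm_apply_apply x

/-! ### Homomorphisms -/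

/-- A map between loops that preserves all loop operations. -/
structure IsLoopHom {P Q : Type u} [Loop P] [Loop Q] (φ : P → Q) : Prop where
  map_one : φ 1 = 1
  map_mul : ∀ x y, φ (x * y) = φ x * φ y
  map_ldiv : ∀ x y, φ (Loop.ldiv x y) = Loop.ldiv (φ x) (φ y)
  map_rdiv : ∀ x y, φ (x / y) = φ x / φ y

theorem IsLoopHom.map_eval {P Q : Type u} [Loop P] [Loop Q] {φ : P → Q} (hφ : IsLoopHom φ)
    {X : Type} (ρ : X → P) (t : LoopTerm X) : φ (t.eval ρ) = t.eval (fun i => φ (ρ i)) := by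
  induction t with
  | var x => rfl
  | one => exact hφ.map_one
  | mul s t hs ht => simp only [LoopTerm.eval, hφ.map_mul, hs, ht]
  | ldiv s t hs ht => simp only [LoopTerm.eval, hφ.map_ldiv, hs, ht]
  | rdiv s t hs ht => simp only [LoopTerm.eval, hφ.map_rdiv, hs, ht]

theorem IsLoopHom.map_toPerm {P Q : Type u} [Loop P] [Loop Q] {φ : P → Q} (hφ : IsLoopHom φ)
    (k : TransKind) (x y : P) : φ (k.toPerm x y) = k.toPerm (φ x) (φ y) := by
  cases k
  · exact hφ.map_mul x y
  · exact hφ.map_mul y x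
  · exact hφ.map_ldiv y x

/-! ### Evaluation of words -/

section Words

variable {Q : Type u} [Loop Q] {n : ℕ}

theorem Word.eval_one (a : Fin n → Q) : Word.eval 1 a = 1 := map_one _

theorem Word.eval_mul (w w' : Word n) (a : Fin n → Q) :
    Word.eval (w * w') a = w.eval a * w'.eval a := map_mul _ _ _

theorem Word.eval_inv (w : Word n) (a : Fin n → Q) : Word.eval w⁻¹ a = (w.eval a)⁻¹ :=
  map_inv _ _

theorem Word.eval_of (k : TransKind × LoopTerm (Fin n)) (a : Fin n → Q) :
    Word.eval (FreeGroup.of k) a = k.1.toPerm (k.2.eval a) := FreeGroup.lift_apply_of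

theorem IsLoopHom.map_word {P : Type u} [Loop P] {φ : P → Q} (hφ : IsLoopHom φ)
    (w : Word n) (a : Fin n → P) (x : P) :
    φ (w.eval a x) = w.eval (fun i => φ (a i)) (φ x) := by
  induction w using FreeGroup.induction_on generalizing x with
  | C1 => simp [Word.eval_one]
  | of k => rw [Word.eval_of, Word.eval_of, hφ.map_toPerm, hφ.map_eval]
  | inv_of k h =>
    rw [Word.eval_inv, Word.eval_inv, Equiv.Perm.eq_inv_iff_eq, ← h, perm_apply_inv_self]
  | mul w w' h h' => rw [Word.eval_mul, Word.eval_mul, Equiv.Perm.mul_apply,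
      Equiv.Perm.mul_apply, h, h']

theorem LoopTerm.exists_eval_cons (t : LoopTerm (Fin n)) : ∃ t' : LoopTerm (Fin (n + 1)),
    ∀ (a : Q) (u : Fin n → Q), t'.eval (Fin.cons a u : Fin (n + 1) → Q) = t.eval u := by
  induction t with
  | var x => exact ⟨.var x.succ, fun a u => rfl⟩
  | one => exact ⟨.one, fun a u => rfl⟩
  | mul s t hs ht =>
    obtain ⟨s', hs⟩ := hs
    obtain ⟨t', ht⟩ := ht
    exact ⟨.mul s' t', fun a u => by simp only [LoopTerm.eval, hs, ht]⟩
  | ldiv s t hs ht =>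
    obtain ⟨s', hs⟩ := hs
    obtain ⟨t', ht⟩ := ht
    exact ⟨.ldiv s' t', fun a u => by simp only [LoopTerm.eval, hs, ht]⟩
  | rdiv s t hs ht =>
    obtain ⟨s', hs⟩ := hs
    obtain ⟨t', ht⟩ := ht
    exact ⟨.rdiv s' t', fun a u => by simp only [LoopTerm.eval, hs, ht]⟩

/-- Inverses of letters are loop operations as well: `L_x⁻¹ y = x \ y`, `R_x⁻¹ y = y / x`, `M_x⁻¹ y
= x / y`. The inner term `s` is arbitrary so that the induction passes through products of words. -/
theorem Word.exists_term_comp (w : Word n) (s : LoopTerm (Fin (n + 1))) :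
    ∃ t : LoopTerm (Fin (n + 1)), ∀ (a : Q) (u : Fin n → Q),
      t.eval (Fin.cons a u : Fin (n + 1) → Q) =
        w.eval u (s.eval (Fin.cons a u : Fin (n + 1) → Q)) := by
  induction w using FreeGroup.induction_on generalizing s with
  | C1 => exact ⟨s, fun a u => by simp [Word.eval_one]⟩
  | of k =>
    obtain ⟨k, t⟩ := k
    obtain ⟨t', ht⟩ := t.exists_eval_cons (Q := Q)
    cases k
    · refine ⟨.mul t' s, fun a u => ?_⟩
      rw [Word.eval_of, LoopTerm.eval, ht]
      rfl
    · refine ⟨.mul s t', fun a u => ?_⟩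
      rw [Word.eval_of, LoopTerm.eval, ht]
      rfl
    · refine ⟨.ldiv s t', fun a u => ?_⟩
      rw [Word.eval_of, LoopTerm.eval, ht]
      rfl
  | inv_of k _ =>
    obtain ⟨k, t⟩ := k
    obtain ⟨t', ht⟩ := t.exists_eval_cons (Q := Q)
    cases k
    · refine ⟨.ldiv t' s, fun a u => ?_⟩
      rw [Word.eval_inv, Word.eval_of, LoopTerm.eval, ht]
      rfl
    · refine ⟨.rdiv s t', fun a u => ?_⟩
      rw [Word.eval_inv, Word.eval_of, LoopTerm.eval, ht]
      rfl
    · refine ⟨.rdiv t' s, fun a u => ?_⟩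
      rw [Word.eval_inv, Word.eval_of, LoopTerm.eval, ht]
      rfl
  | mul w w' h h' =>
    obtain ⟨t', ht'⟩ := h' s
    obtain ⟨t, ht⟩ := h t'
    exact ⟨t, fun a u => by rw [ht, ht', Word.eval_mul, Equiv.Perm.mul_apply]⟩

/-- The value `W_ū(a)` is given by a loop term in `a, ū`. -/
theorem Word.exists_term (w : Word n) : ∃ t : LoopTerm (Fin (n + 1)), ∀ (a : Q) (u : Fin n → Q),
    t.eval (Fin.cons a u : Fin (n + 1) → Q) = w.eval u a :=
  w.exists_term_comp (.var 0)

theorem Word.IsInner.eval_apply_one {V : LoopClass.{u}} {w : Word n} (hw : w.IsInner V)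
    (hQ : V Q) (a : Fin n → Q) : w.eval a 1 = 1 :=
  (hw Q hQ a).2

end Words

/-! ### Congruences -/

namespace LoopCon

variable {Q : Type u} [Loop Q]

theorem rel_refl (α : LoopCon Q) (x : Q) : α.Rel x x := α.iseqv.refl x

theorem Rel.symm {α : LoopCon Q} {x y : Q} (h : α.Rel x y) : α.Rel y x := α.iseqv.symm h

theorem Rel.trans {α : LoopCon Q} {x y z : Q} (h : α.Rel x y) (h' : α.Rel y z) : α.Rel x z :=
  α.iseqv.trans h h'

theorem Rel.mul {α : LoopCon Q} {w x y z : Q} (h : α.Rel w x) (h' : α.Rel y z) :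
    α.Rel (w * y) (x * z) := α.mul' h h'

theorem Rel.ldiv {α : LoopCon Q} {w x y z : Q} (h : α.Rel w x) (h' : α.Rel y z) :
    α.Rel (Loop.ldiv w y) (Loop.ldiv x z) := α.ldiv' h h'

theorem Rel.rdiv {α : LoopCon Q} {w x y z : Q} (h : α.Rel w x) (h' : α.Rel y z) :
    α.Rel (w / y) (x / z) := α.rdiv' h h'

theorem Rel.eval (α : LoopCon Q) {X : Type} {ρ σ : X → Q} (h : ∀ i, α.Rel (ρ i) (σ i))
    (t : LoopTerm X) : α.Rel (t.eval ρ) (t.eval σ) := by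
  induction t with
  | var x => exact h x
  | one => exact α.rel_refl 1
  | mul s t hs ht => exact hs.mul ht
  | ldiv s t hs ht => exact hs.ldiv ht
  | rdiv s t hs ht => exact hs.rdiv ht

theorem Rel.word {α : LoopCon Q} {n : ℕ} (w : Word n) (u : Fin n → Q) {x y : Q}
    (h : α.Rel x y) : α.Rel (w.eval u x) (w.eval u y) := by
  obtain ⟨t, ht⟩ := w.exists_term (Q := Q)
  rw [← ht, ← ht]
  refine Rel.eval α (fun i => ?_) t
  cases i using Fin.cases with
  | zero => exact h
  | succ i => exact α.rel_refl _

/-- The loop of all pairs of congruent elements, a subloop of `Q × Q`. -/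
def Pairs (β : LoopCon Q) : Type u := {p : Q × Q // β.Rel p.1 p.2}

instance (β : LoopCon Q) : Loop β.Pairs where
  one := ⟨(1, 1), β.rel_refl 1⟩
  mul p q := ⟨(p.1.1 * q.1.1, p.1.2 * q.1.2), p.2.mul q.2⟩
  div p q := ⟨(p.1.1 / q.1.1, p.1.2 / q.1.2), p.2.rdiv q.2⟩
  ldiv p q := ⟨(Loop.ldiv p.1.1 q.1.1, Loop.ldiv p.1.2 q.1.2), p.2.ldiv q.2⟩
  one_mul p := Subtype.ext (Prod.ext (one_mul p.1.1) (one_mul p.1.2))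
  mul_one p := Subtype.ext (Prod.ext (mul_one p.1.1) (mul_one p.1.2))
  ldiv_mul_cancel_left _ _ := Subtype.ext
    (Prod.ext (Loop.ldiv_mul_cancel_left _ _) (Loop.ldiv_mul_cancel_left _ _))
  mul_ldiv_cancel_left _ _ := Subtype.ext
    (Prod.ext (Loop.mul_ldiv_cancel_left _ _) (Loop.mul_ldiv_cancel_left _ _))
  mul_div_cancel_right _ _ := Subtype.ext
    (Prod.ext (Loop.mul_div_cancel_right _ _) (Loop.mul_div_cancel_right _ _))
  div_mul_cancel_right _ _ := Subtype.ext
    (Prod.ext (Loop.div_mul_cancel_right _ _) (Loop.div_mul_cancel_right _ _))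

/-- The first projection. -/
def Pairs.fst {β : LoopCon Q} (p : β.Pairs) : Q := p.1.1

/-- The second projection. -/
def Pairs.snd {β : LoopCon Q} (p : β.Pairs) : Q := p.1.2

theorem Pairs.rel {β : LoopCon Q} (p : β.Pairs) : β.Rel p.fst p.snd := p.2

theorem Pairs.ext {β : LoopCon Q} {p q : β.Pairs} (h₁ : p.fst = q.fst) (h₂ : p.snd = q.snd) :
    p = q := Subtype.ext (Prod.ext h₁ h₂)

theorem Pairs.isLoopHom_fst (β : LoopCon Q) : IsLoopHom (Pairs.fst (β := β)) :=
  ⟨rfl, fun _ _ => rfl, fun _ _ => rfl, fun _ _ => rfl⟩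

theorem Pairs.isLoopHom_snd (β : LoopCon Q) : IsLoopHom (Pairs.snd (β := β)) :=
  ⟨rfl, fun _ _ => rfl, fun _ _ => rfl, fun _ _ => rfl⟩

/-- Identities are checked coordinatewise. This allows the generation hypothesis to be applied to
`β` itself rather than to `Q`. -/
theorem pairs_mem_variety {V : LoopClass.{u}} (hV : IsVariety V) (hQ : V Q) (β : LoopCon Q) :
    V β.Pairs := by
  obtain ⟨E, hE⟩ := hV
  rw [hE] at hQ ⊢
  intro e he ρ
  apply Pairs.ext
  · rw [(Pairs.isLoopHom_fst β).map_eval, (Pairs.isLoopHom_fst β).map_eval]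
    exact hQ e he _
  · rw [(Pairs.isLoopHom_snd β).map_eval, (Pairs.isLoopHom_snd β).map_eval]
    exact hQ e he _

end LoopCon

/-! ### Normal subloops -/

section Normal

variable {Q : Type u} [Loop Q]

theorem leftTrans_mem_totMlt (x : Q) : leftTrans x ∈ totMlt Q :=
  Subgroup.subset_closure (.inl (.inl ⟨x, rfl⟩))

theorem rightTrans_mem_totMlt (x : Q) : rightTrans x ∈ totMlt Q :=
  Subgroup.subset_closure (.inl (.inr ⟨x, rfl⟩))

theorem midTrans_mem_totMlt (x : Q) : midTrans x ∈ totMlt Q :=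
  Subgroup.subset_closure (.inr ⟨x, rfl⟩)

theorem rightTrans_inv_apply_self (x : Q) : (rightTrans x)⁻¹ x = 1 := by
  rw [Equiv.Perm.inv_eq_iff_eq]
  exact (one_mul x).symm

/-- A set containing `1`, closed under products and right quotients, and invariant under total inner
mappings. -/
structure IsNormalSubloop (N : Set Q) : Prop where
  one_mem : 1 ∈ N
  mul_mem : ∀ {x y}, x ∈ N → y ∈ N → x * y ∈ N
  rdiv_mem : ∀ {x y}, x ∈ N → y ∈ N → x / y ∈ N
  inn_mem : ∀ {f}, f ∈ totInn Q → ∀ {x}, x ∈ N → f x ∈ N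

/-- Congruence modulo a normal subloop. -/
def modRel (N : Set Q) (x y : Q) : Prop := ∃ f ∈ totMlt Q, f y = 1 ∧ f x ∈ N

namespace IsNormalSubloop

variable {N : Set Q}

/-- The choice of witness in `modRel` is immaterial: two elements of the total multiplication group
that send `y` to `1` differ by a total inner mapping, which preserves `N`. -/
theorem apply_mem (hN : IsNormalSubloop N) {x y : Q} (h : modRel N x y) {g : Equiv.Perm Q} (hg : g ∈ totMlt Q)
    (hy : g y = 1) : g x ∈ N := by
  obtain ⟨f, hf, hfy, hfx⟩ := h
  have key : g * f⁻¹ ∈ totInn Q := by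
    refine ⟨Subgroup.mul_mem _ hg (inv_mem hf), ?_⟩
    change g (f⁻¹ 1) = 1
    rw [Equiv.Perm.inv_eq_iff_eq.2 hfy.symm, hy]
  simpa using hN.inn_mem key hfx

theorem modRel_symm (hN : IsNormalSubloop N) {x y : Q} (h : modRel N x y) : modRel N y x := by
  obtain ⟨f, hf, hfy, hfx⟩ := h
  refine ⟨(rightTrans (f x))⁻¹ * f, Subgroup.mul_mem _ (inv_mem (rightTrans_mem_totMlt _)) hf,
    rightTrans_inv_apply_self _, ?_⟩
  rw [Equiv.Perm.mul_apply, hfy]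
  exact hN.rdiv_mem hN.one_mem hfx

theorem modRel_refl (hN : IsNormalSubloop N) (x : Q) : modRel N x x :=
  ⟨(rightTrans x)⁻¹, inv_mem (rightTrans_mem_totMlt _), rightTrans_inv_apply_self x,
    (rightTrans_inv_apply_self x).symm ▸ hN.one_mem⟩

theorem modRel_trans (hN : IsNormalSubloop N) {x y z : Q} (h : modRel N x y) (h' : modRel N y z) : modRel N x z := by
  obtain ⟨f, hf, hfz, hfy⟩ := h'
  refine ⟨f, hf, hfz, ?_⟩
  have := hN.apply_mem h (Subgroup.mul_mem _ (inv_mem (rightTrans_mem_totMlt (f y))) hf)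
    (rightTrans_inv_apply_self (f y))
  have h2 : f x / f y * f y ∈ N := hN.mul_mem this hfy
  rwa [Loop.div_mul_cancel_right] at h2

end IsNormalSubloop

theorem modRel.apply {N : Set Q} {x y : Q} (h : modRel N x y) {g : Equiv.Perm Q}
    (hg : g ∈ totMlt Q) : modRel N (g x) (g y) := by
  obtain ⟨f, hf, hfy, hfx⟩ := h
  exact ⟨f * g⁻¹, Subgroup.mul_mem _ hf (inv_mem hg), by simpa using hfy, by simpa using hfx⟩

/-- The congruence whose class of `1` is the given normal subloop. -/
def IsNormalSubloop.con {N : Set Q} (hN : IsNormalSubloop N) : LoopCon Q where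
  r := modRel N
  iseqv := ⟨hN.modRel_refl, hN.modRel_symm, hN.modRel_trans⟩
  -- Changing one argument at a time applies a translation or its inverse, and `modRel` is invariant
  -- under these.
  mul' {_ x y _} h h' := hN.modRel_trans (h.apply (rightTrans_mem_totMlt y))
    (h'.apply (leftTrans_mem_totMlt x))
  ldiv' {_ x y _} h h' := hN.modRel_trans (h.apply (midTrans_mem_totMlt y))
    (h'.apply (inv_mem (leftTrans_mem_totMlt x)))
  rdiv' {_ x y _} h h' := hN.modRel_trans (h.apply (inv_mem (rightTrans_mem_totMlt y)))
    (h'.apply (inv_mem (midTrans_mem_totMlt x)))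

theorem IsNormalSubloop.con_rel_iff {N : Set Q} (hN : IsNormalSubloop N) {x y : Q} :
    hN.con.Rel x y ↔ x / y ∈ N :=
  ⟨fun h => hN.apply_mem h (inv_mem (rightTrans_mem_totMlt y)) (rightTrans_inv_apply_self y),
    fun h => ⟨(rightTrans y)⁻¹, inv_mem (rightTrans_mem_totMlt y),
      rightTrans_inv_apply_self y, h⟩⟩

end Normal

/-! ### The term condition -/

namespace LoopCon

variable {Q : Type u} [Loop Q]

/-- The pairs in `β` that are congruent modulo `δ`, and congruent to `1` modulo `α` in the first
coordinate. -/
def nearDiagonal (α β δ : LoopCon Q) : Set β.Pairs :=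
  {p | α.Rel 1 p.fst ∧ δ.Rel p.fst p.snd}

/-- The pairs `(t(a, ū), t(a, v̄))` and `(t(b, ū), t(b, v̄))` are congruent modulo the normal
subloop, so the two coordinates of their quotient are `δ`-related. Cancelling the `δ`-related
numerators leaves the term condition. -/
theorem centralizes_of_isNormalSubloop {α β δ : LoopCon Q}
    (hN : IsNormalSubloop (nearDiagonal α β δ)) : Centralizes α β δ := by
  intro n t a b u v hab huv h
  let diag (x : Q) : β.Pairs := ⟨(x, x), β.rel_refl x⟩
  let c (i : Fin n) : β.Pairs := ⟨(u i, v i), huv i⟩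
  have hdiag : hN.con.Rel (diag a) (diag b) := by
    rw [hN.con_rel_iff]
    refine ⟨?_, δ.rel_refl _⟩
    have h1 : α.Rel (b / b) (a / b) := Rel.rdiv hab.symm (α.rel_refl b)
    have h2 : b / b = 1 := by simpa using Loop.mul_div_cancel_right b 1
    rwa [h2] at h1
  have hfst (x : Q) : (t.eval (Fin.cons (diag x) c : Fin (n + 1) → β.Pairs)).fst =
      t.eval (Fin.cons x u : Fin (n + 1) → Q) := by
    rw [(Pairs.isLoopHom_fst β).map_eval]
    congr 1
    funext i
    cases i using Fin.cases <;> rfl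
  have hsnd (x : Q) : (t.eval (Fin.cons (diag x) c : Fin (n + 1) → β.Pairs)).snd =
      t.eval (Fin.cons x v : Fin (n + 1) → Q) := by
    rw [(Pairs.isLoopHom_snd β).map_eval]
    congr 1
    funext i
    cases i using Fin.cases <;> rfl
  have key : hN.con.Rel (t.eval (Fin.cons (diag a) c : Fin (n + 1) → β.Pairs))
      (t.eval (Fin.cons (diag b) c : Fin (n + 1) → β.Pairs)) := by
    refine Rel.eval _ (fun i => ?_) t
    cases i using Fin.cases with
    | zero => exact hdiag
    | succ i => exact hN.con.rel_refl _
  have hquot := (hN.con_rel_iff.1 key).2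
  rw [(Pairs.isLoopHom_fst β).map_rdiv, (Pairs.isLoopHom_snd β).map_rdiv, hfst, hfst, hsnd,
    hsnd] at hquot
  have hcancel (x y : Q) : Loop.ldiv (x / y) x = y := (midTrans x).right_inv y
  have := hquot.ldiv h
  rwa [hcancel, hcancel] at this

theorem isNormalSubloop_nearDiagonal {V : LoopClass.{u}} (hV : IsVariety V)
    {𝒲 : Set (Σ n : ℕ, Word n)} (h𝒲 : GeneratesTotInn V 𝒲) (hQ : V Q) {α β δ : LoopCon Q}
    (hδ : ∀ w ∈ 𝒲, ∀ (a : Q) (u v : Fin w.1 → Q), α.Rel 1 a → (∀ i, β.Rel (u i) (v i)) →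
      δ.Rel (w.2.eval u a) (w.2.eval v a)) :
    IsNormalSubloop (nearDiagonal α β δ) where
  one_mem := ⟨α.rel_refl 1, δ.rel_refl 1⟩
  mul_mem hx hy := by
    have h := hx.1.mul hy.1
    rw [one_mul] at h
    exact ⟨h, hx.2.mul hy.2⟩
  rdiv_mem hx hy := by
    have h1 : (1 : Q) / 1 = 1 := by simpa using Loop.mul_div_cancel_right (1 : Q) 1
    have h2 := hx.1.rdiv hy.1
    rw [h1] at h2
    exact ⟨h2, hx.2.rdiv hy.2⟩
  inn_mem {f} hf {p} hp := by
    rw [h𝒲.2 β.Pairs (pairs_mem_variety hV hQ β)] at hf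
    have hword : ∀ w ∈ 𝒲, ∀ (c : Fin w.1 → β.Pairs), ∀ p ∈ nearDiagonal α β δ,
        w.2.eval c p ∈ nearDiagonal α β δ ∧ (w.2.eval c)⁻¹ p ∈ nearDiagonal α β δ := by
      intro w hw c p hp
      have hone := (h𝒲.1 w hw).eval_apply_one hQ (fun i => (c i).fst)
      constructor
      · refine ⟨?_, ?_⟩
        -- An inner word fixes `1`, hence preserves the `α`-class of `1`.
        · rw [(Pairs.isLoopHom_fst β).map_word]
          simpa [hone] using hp.1.word w.2 (fun i => (c i).fst)
        · rw [(Pairs.isLoopHom_fst β).map_word, (Pairs.isLoopHom_snd β).map_word]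
          -- For `p = (x, y)`: `W_ū(x) δ W_v̄(x) δ W_v̄(y)`.
          exact (hδ w hw _ _ _ hp.1 fun i => (c i).rel).trans (hp.2.word w.2 _)
      · rw [← Word.eval_inv]
        have hone' : Word.eval w.2⁻¹ (fun i => (c i).fst) 1 = 1 := by
          rw [Word.eval_inv, Equiv.Perm.inv_eq_iff_eq, hone]
        have h1 := hp.1.word w.2⁻¹ (fun i => (c i).fst)
        rw [hone'] at h1
        refine ⟨by rwa [(Pairs.isLoopHom_fst β).map_word], ?_⟩
        rw [(Pairs.isLoopHom_fst β).map_word, (Pairs.isLoopHom_snd β).map_word]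
        -- Apply the hypothesis at `x' = W_ū⁻¹(x)`, still `α`-related to `1`: `x = W_ū(x') δ
        -- W_v̄(x')`. Since `x δ y`, applying `W_v̄⁻¹` gives `x' δ W_v̄⁻¹(y)`.
        have h2 := hδ w hw _ _ _ h1 fun i => (c i).rel
        rw [Word.eval_inv, perm_apply_inv_self] at h2
        have h3 := (h2.symm.trans hp.2).word w.2⁻¹ (fun i => (c i).snd)
        rwa [Word.eval_inv _ (fun i => (c i).snd), perm_inv_apply_self,
          ← Word.eval_inv, ← Word.eval_inv] at h3
    induction hf using Subgroup.closure_induction'' generalizing p with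
    | mem f hf =>
      obtain ⟨w, hw, c, rfl⟩ := hf
      exact (hword w hw c p hp).1
    | inv_mem f hf =>
      obtain ⟨w, hw, c, rfl⟩ := hf
      exact (hword w hw c p hp).2
    | one => exact hp
    | mul f g _ _ hf hg => exact hf (hg hp)

end LoopCon

end LoopTheory

theorem theorem2p1 (V : LoopTheory.LoopClass.{u}) (hV : LoopTheory.IsVariety V)
    (𝒲 : Set (Σ n : ℕ, LoopTheory.Word n)) (h𝒲 : LoopTheory.GeneratesTotInn V 𝒲)
    (Q : Type u) [LoopTheory.Loop Q] (hQ : V Q) (α β : LoopTheory.LoopCon Q) :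
    LoopTheory.LoopCon.commutator α β =
      LoopTheory.LoopCon.gen
        {p : Q × Q | ∃ w ∈ 𝒲, ∃ (a : Q) (u v : Fin w.1 → Q),
          α.Rel 1 a ∧ (∀ i, β.Rel (u i) (v i)) ∧ p = (w.2.eval u a, w.2.eval v a)} := by
  open LoopTheory LoopTheory.LoopCon in
  apply le_antisymm
  · refine (isLeast_commutator α β).2 (centralizes_of_isNormalSubloop
      (isNormalSubloop_nearDiagonal hV h𝒲 hQ fun w hw a u v ha huv => ?_))
    exact (isLeast_gen _).1 (w.2.eval u a, w.2.eval v a) ⟨w, hw, a, u, v, ha, huv, rfl⟩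
  · refine (isLeast_gen _).2 ?_
    rintro _ ⟨w, hw, a, u, v, ha, huv, rfl⟩
    obtain ⟨t, ht⟩ := w.2.exists_term (Q := Q)
    -- The premise `t(1, ū) δ t(1, v̄)` reads `1 δ 1`, as inner words fix `1`.
    have h := (isLeast_commutator α β).1 w.1 t 1 a u v ha huv
    simp only [ht] at h
    rw [(h𝒲.1 w hw).eval_apply_one hQ, (h𝒲.1 w hw).eval_apply_one hQ] at h
    exact h (rel_refl _ 1)
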